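/- Let $0<p\le q$ be integers and $n=p+q$. Equip $\mathbb C^n$ with the Hermitian form $\langle v,w\rangle=-\sum_{i=1}^p\overline{v_i}\,w_i+\sum_{i=p+1}^{n}\overline{v_i}\,w_i$; let $A^*=s\bar A^{t}s$, with $s=\operatorname{diag}(-I_p,I_q)$, be the adjoint of an $n\times n$ matrix $A$ with respect to this form, and let $L^\perp$ be the orthogonal complement of a subspace $L$ with respect to this form. A subspace is called isotropic if $\langle\cdot,\cdot\rangle$ vanishes identically on it. Let $\mathcal L^-U_{p,q}$ be the group of all non-degenerate (determinant not identically zero) $n\times n$ matrices $g$ of rational functions of $\lambda$ over $\mathbb C$ that are normalized by $g(\infty)=I$ and satisfy the reality condition $\tau(g(\bar\lambda))=g(\lambda)$, where $\tau(A)=(A^*)^{-1}$. Then $\mathcal L^-U_{p,q}$ is generated, as a group, by the following two families of loops, all of which belong to it: 1. $p_{\alpha,L}(\lambda)=\dfrac{\lambda-\alpha}{\lambda-\bar\alpha}\,\pi_L+\pi_{L^\perp}$, where $\alpha\in\mathbb C$, $L\subset\mathbb C^n$ is a non-isotropic complex line, and $\pi_L,\pi_{L^\perp}$ are the projections belonging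 to the decomposition $\mathbb C^n=L\oplus L^\perp$; 2. $g_{\alpha,\beta,L,K,W}(\lambda)=\dfrac{\lambda-\alpha}{\lambda-\beta}\,\pi_L+\dfrac{\lambda-\bar\beta}{\lambda-\bar\alpha}\,\pi_K+\pi_W$, where $\alpha,\beta\in\mathbb C$, $L,K\subset\mathbb C^n$ are isotropic complex lines with $\langle L,K\rangle\neq0$, $W=L^\perp\cap K^\perp$, and $\pi_L,\pi_K,\pi_W$ are the projections belonging to the decomposition $\mathbb C^n=L\oplus K\oplus W$. -/

import Mathlib

noncomputable section

namespace LoopUpq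

open Matrix

/-! ### The Hermitian form of signature `(p, q)` on `ℂⁿ`, `n = p + q` -/

/-- The space `ℂⁿ = ℂᵖ ⊕ ℂ^q` of column vectors. -/
abbrev Vec (p q : ℕ) : Type := Fin p ⊕ Fin q → ℂ

/-- The matrix `s = diag(-I_p, I_q)`, with entries in any ring. -/
def sgn (p q : ℕ) (R : Type*) [Ring R] : Matrix (Fin p ⊕ Fin q) (Fin p ⊕ Fin q) R :=
  Matrix.diagonal (Sum.elim (fun _ => -1) (fun _ => 1))

/-- The form `⟨v, w⟩ = -∑_{i ≤ p} conj(vᵢ) wᵢ + ∑_{i > p} conj(vᵢ) wᵢ`,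
conjugate-linear in `v` and linear in `w`. -/
def form (p q : ℕ) : Vec p q →ₗ⋆[ℂ] Vec p q →ₗ[ℂ] ℂ :=
  LinearMap.mk₂'ₛₗ (starRingEnd ℂ) (RingHom.id ℂ)
    (fun v w => -(∑ i : Fin p, (starRingEnd ℂ) (v (Sum.inl i)) * w (Sum.inl i)) +
      ∑ j : Fin q, (starRingEnd ℂ) (v (Sum.inr j)) * w (Sum.inr j))
    (by intro v v' w
        simp only [Pi.add_apply, map_add, add_mul, Finset.sum_add_distrib]; ring)
    (by intro c v w
        simp only [Pi.smul_apply, smul_eq_mul, map_mul, mul_assoc, ← Finset.mul_sum]; ring)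
    (by intro v w w'
        simp only [Pi.add_apply, mul_add, Finset.sum_add_distrib]; ring)
    (by intro c v w
        simp only [Pi.smul_apply, smul_eq_mul, RingHom.id_apply, mul_left_comm _ c,
          ← Finset.mul_sum]; ring)

lemma form_symm {p q : ℕ} (v w : Vec p q) :
    (starRingEnd ℂ) (form p q v w) = form p q w v := by
  simp [form, mul_comm]

/-- The orthogonal complement `L^⊥` with respect to `form`. -/
def perp {p q : ℕ} (L : Submodule ℂ (Vec p q)) : Submodule ℂ (Vec p q) :=
  L.orthogonalBilin (form p q)

/-- `L` is a complex line. -/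
def IsLine {p q : ℕ} (L : Submodule ℂ (Vec p q)) : Prop := Module.finrank ℂ L = 1

/-- `L` is isotropic: the form vanishes identically on `L`. -/
def Isotropic {p q : ℕ} (L : Submodule ℂ (Vec p q)) : Prop :=
  ∀ v ∈ L, ∀ w ∈ L, form p q v w = 0

/-- `⟨L, K⟩ ≠ 0`, that is, the form does not vanish identically on `L × K`. -/
def GeneralPosition {p q : ℕ} (L K : Submodule ℂ (Vec p q)) : Prop :=
  ∃ v ∈ L, ∃ w ∈ K, form p q v w ≠ 0

/-- `W = L^⊥ ∩ K^⊥`. -/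
def third {p q : ℕ} (L K : Submodule ℂ (Vec p q)) : Submodule ℂ (Vec p q) :=
  perp L ⊓ perp K

lemma third_comm {p q : ℕ} (L K : Submodule ℂ (Vec p q)) : third L K = third K L := inf_comm _ _

lemma GeneralPosition.symm {p q : ℕ} {L K : Submodule ℂ (Vec p q)} (h : GeneralPosition L K) :
    GeneralPosition K L := by
  obtain ⟨v, hv, w, hw, h⟩ := h
  refine ⟨w, hw, v, hv, fun h0 => h ?_⟩
  rw [← form_symm, h0, map_zero]

lemma GeneralPosition.exists_span {p q : ℕ} {L K : Submodule ℂ (Vec p q)} (hL : IsLine L)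
    (hK : IsLine K) (h : GeneralPosition L K) :
    ∃ v w, L = Submodule.span ℂ {v} ∧ K = Submodule.span ℂ {w} ∧
      form p q v w ≠ 0 ∧ form p q w v ≠ 0 := by
  obtain ⟨v, hv, w, hw, h⟩ := h
  have key : ∀ (M : Submodule ℂ (Vec p q)) (u : Vec p q), IsLine M → u ∈ M → u ≠ 0 →
      M = Submodule.span ℂ {u} := by
    intro M u hM hu hu0
    symm
    apply Submodule.eq_of_le_of_finrank_eq
    · rw [Submodule.span_singleton_le_iff_mem]; exact hu
    · rw [finrank_span_singleton hu0]; exact hM.symm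
  refine ⟨v, w, key L v hL hv ?_, key K w hK hw ?_, h, ?_⟩
  · rintro rfl; simp at h
  · rintro rfl; simp at h
  · intro h0; apply h; rw [← form_symm, h0, map_zero]

/-- `ℂⁿ = L ⊕ L^⊥` for a non-isotropic line `L`. -/
lemma isCompl_perp {p q : ℕ} {L : Submodule ℂ (Vec p q)} (hL : IsLine L) (h : ¬ Isotropic L) :
    IsCompl L (perp L) := by
  have h' : GeneralPosition L L := by
    unfold Isotropic at h; push Not at h; exact h
  obtain ⟨v, hv, w, hw, hvw⟩ := h'
  obtain ⟨u, u', hu, hu', -⟩ := GeneralPosition.exists_span hL hL ⟨v, hv, w, hw, hvw⟩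
  have huu : form p q u u ≠ 0 := by
    rw [hu, Submodule.mem_span_singleton] at hv hw
    obtain ⟨a, rfl⟩ := hv
    obtain ⟨b, rfl⟩ := hw
    intro h0; apply hvw; simp [h0]
  have hmem : u ∈ L := hu ▸ Submodule.mem_span_singleton_self u
  refine ⟨Submodule.disjoint_def.2 fun x hx hx' => ?_, codisjoint_iff.2 (eq_top_iff.2 fun x _ => ?_)⟩
  · rw [hu, Submodule.mem_span_singleton] at hx
    obtain ⟨a, rfl⟩ := hx
    have := hx' u hmem
    simp only [map_smul, smul_eq_mul, mul_eq_zero] at this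
    rcases this with h0 | h0
    · simp [h0]
    · exact absurd h0 huu
  · refine Submodule.mem_sup.2 ⟨(form p q u x / form p q u u) • u, L.smul_mem _ hmem,
      x - (form p q u x / form p q u u) • u, ?_, by simp⟩
    intro y hy
    rw [hu, Submodule.mem_span_singleton] at hy
    obtain ⟨a, rfl⟩ := hy
    simp [huu]

/-- `ℂⁿ = L ⊕ K ⊕ W` for isotropic lines `L`, `K` in general position: `L` and `K ⊕ W` are
complementary. -/
lemma isCompl_line {p q : ℕ} {L K : Submodule ℂ (Vec p q)} (hL : IsLine L) (hK : IsLine K)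
    (iL : Isotropic L) (iK : Isotropic K) (h : GeneralPosition L K) :
    IsCompl L (K ⊔ third L K) := by
  obtain ⟨v, w, rfl, rfl, hvw, hwv⟩ := h.exists_span hL hK
  have hv := Submodule.mem_span_singleton_self (R := ℂ) v
  have hw := Submodule.mem_span_singleton_self (R := ℂ) w
  have hvv := iL v hv v hv
  have hww := iK w hw w hw
  refine ⟨Submodule.disjoint_def.2 fun x hx hx' => ?_, codisjoint_iff.2 (eq_top_iff.2 fun x _ => ?_)⟩
  · obtain ⟨a, rfl⟩ := Submodule.mem_span_singleton.1 hx
    obtain ⟨k, hk, t, ht, e⟩ := Submodule.mem_sup.1 hx'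
    obtain ⟨b, rfl⟩ := Submodule.mem_span_singleton.1 hk
    have h1 := ht.2 w hw
    have h2 := congrArg (form p q w) e
    simp only [map_add, map_smul, hww, h1, smul_eq_mul, mul_zero, add_zero] at h2
    rcases mul_eq_zero.1 h2.symm with h0 | h0
    · simp [h0]
    · exact absurd h0 hwv
  · refine Submodule.mem_sup.2 ⟨(form p q w x / form p q w v) • v, Submodule.smul_mem _ _ hv,
      x - (form p q w x / form p q w v) • v, ?_, by simp⟩
    refine Submodule.mem_sup.2 ⟨(form p q v x / form p q v w) • w, Submodule.smul_mem _ _ hw,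
      x - (form p q w x / form p q w v) • v - (form p q v x / form p q v w) • w, ⟨?_, ?_⟩, by simp⟩
    · intro y hy
      obtain ⟨a, rfl⟩ := Submodule.mem_span_singleton.1 hy
      simp [hvv, hvw]
    · intro y hy
      obtain ⟨a, rfl⟩ := Submodule.mem_span_singleton.1 hy
      simp [hww, hwv]

/-- `ℂⁿ = L ⊕ K ⊕ W`: `W` and `L ⊕ K` are complementary. -/
lemma isCompl_third {p q : ℕ} {L K : Submodule ℂ (Vec p q)} (hL : IsLine L) (hK : IsLine K)
    (iL : Isotropic L) (iK : Isotropic K) (h : GeneralPosition L K) :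
    IsCompl (third L K) (L ⊔ K) := by
  have h1 := isCompl_line hL hK iL iK h
  have h2 := isCompl_line hK hL iK iL h.symm
  refine ⟨Submodule.disjoint_def.2 fun x hx hx' => ?_, codisjoint_iff.2 ?_⟩
  · obtain ⟨l, hl, k, hk, rfl⟩ := Submodule.mem_sup.1 hx'
    have el : l = 0 := by
      refine Submodule.disjoint_def.1 h1.disjoint l hl (Submodule.mem_sup.2 ⟨-k, K.neg_mem hk,
        l + k, hx, by abel⟩)
    have ek : k = 0 := by
      refine Submodule.disjoint_def.1 h2.disjoint k hk (Submodule.mem_sup.2 ⟨-l, L.neg_mem hl,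
        l + k, third_comm L K ▸ hx, by abel⟩)
    simp [el, ek]
  · rw [← h1.sup_eq_top, sup_comm, sup_assoc]

/-! ### Rational loops -/

/-- The full group of non-degenerate `n × n` matrices of rational functions of `λ`. -/
abbrev RatGL (p q : ℕ) : Type := GL (Fin p ⊕ Fin q) (RatFunc ℂ)

/-- The rational function `λ ↦ conj (f (conj λ))`: all coefficients of `f` are conjugated. -/
def conjRat : RatFunc ℂ →+* RatFunc ℂ :=
  RatFunc.mapRingHom (Polynomial.mapRingHom (starRingEnd ℂ))
    (nonZeroDivisors_le_comap_nonZeroDivisors_of_injective _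
      (Polynomial.map_injective _ (starRingEnd ℂ).injective))

/-- The loop `λ ↦ g(conj λ)^*`, where `A^* = s (conj A)ᵗ s` is the adjoint of a matrix `A` with
respect to `form`. -/
def loopStar {p q : ℕ} (g : Matrix (Fin p ⊕ Fin q) (Fin p ⊕ Fin q) (RatFunc ℂ)) :
    Matrix (Fin p ⊕ Fin q) (Fin p ⊕ Fin q) (RatFunc ℂ) :=
  sgn p q _ * (g.map conjRat)ᵀ * sgn p q _

/-- The `U_{p,q}`-reality condition `τ(g(conj λ)) = g(λ)`, with `τ(A) = (A^*)⁻¹`. -/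
def RealityUpq {p q : ℕ} (g : RatGL p q) : Prop :=
  (loopStar (g : Matrix (Fin p ⊕ Fin q) (Fin p ⊕ Fin q) (RatFunc ℂ)))⁻¹ = g

open Classical in
/-- The valuation at `∞` on rational functions: `exp (deg (numerator) - deg (denominator))` for a
nonzero function, so that `f` is holomorphic at `∞` iff its valuation is `≤ 1` and vanishes at `∞`
iff its valuation is `< 1`. -/
def vInfty : Valuation (RatFunc ℂ) (WithZero (Multiplicative ℤ)) := RatFunc.inftyValuation ℂ

/-- The normalization `g(∞) = I`: all entries of `g - I` vanish at `∞`, i.e. have valuation `< 1`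
at the place at infinity. -/
def NormalizedAtInfty {p q : ℕ} (g : RatGL p q) : Prop :=
  ∀ i j, vInfty
    ((g : Matrix (Fin p ⊕ Fin q) (Fin p ⊕ Fin q) (RatFunc ℂ)) i j -
      (1 : Matrix (Fin p ⊕ Fin q) (Fin p ⊕ Fin q) (RatFunc ℂ)) i j) < 1

lemma sgn_mul_sgn (p q : ℕ) (R : Type*) [Ring R] : sgn p q R * sgn p q R = 1 := by
  rw [sgn, Matrix.diagonal_mul_diagonal, ← Matrix.diagonal_one]
  congr 1
  funext i
  rcases i with i | i <;> simp

lemma loopStar_one {p q : ℕ} :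
    loopStar (1 : Matrix (Fin p ⊕ Fin q) (Fin p ⊕ Fin q) (RatFunc ℂ)) = 1 := by
  simp [loopStar, Matrix.map_one, sgn_mul_sgn]

lemma loopStar_mul {p q : ℕ} (g h : Matrix (Fin p ⊕ Fin q) (Fin p ⊕ Fin q) (RatFunc ℂ)) :
    loopStar (g * h) = loopStar h * loopStar g := by
  simp only [loopStar, Matrix.map_mul, Matrix.transpose_mul, Matrix.mul_assoc]
  rw [← Matrix.mul_assoc (sgn p q _) (sgn p q _), sgn_mul_sgn, Matrix.one_mul]

lemma NormalizedAtInfty.le_one {p q : ℕ} {g : RatGL p q} (hg : NormalizedAtInfty g) (i j) :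
    vInfty
      ((g : Matrix (Fin p ⊕ Fin q) (Fin p ⊕ Fin q) (RatFunc ℂ)) i j) ≤ 1 := by
  have h1 : vInfty
      ((1 : Matrix (Fin p ⊕ Fin q) (Fin p ⊕ Fin q) (RatFunc ℂ)) i j) ≤ 1 := by
    rw [Matrix.one_apply]; split_ifs <;> simp
  have := vInfty.map_add_le (hg i j).le h1
  simpa using this

lemma NormalizedAtInfty.mul {p q : ℕ} {g h : RatGL p q} (hg : NormalizedAtInfty g)
    (hh : NormalizedAtInfty h) : NormalizedAtInfty (g * h) := by
  intro i j
  have e : ((g * h : RatGL p q) : Matrix (Fin p ⊕ Fin q) (Fin p ⊕ Fin q) (RatFunc ℂ)) - 1 =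
      (g.1 - 1) * h.1 + (h.1 - 1) := by
    rw [Units.val_mul]; noncomm_ring
  have e' := congrFun (congrFun e i) j
  rw [Matrix.sub_apply, Matrix.add_apply, Matrix.mul_apply] at e'
  rw [e']
  refine vInfty.map_add_lt ?_ (hh i j)
  refine vInfty.map_sum_lt one_ne_zero fun k _ => ?_
  rw [map_mul]
  exact mul_lt_one_of_lt_of_le (hg i k) (hh.le_one k j)

lemma NormalizedAtInfty.inv {p q : ℕ} {g : RatGL p q} (hg : NormalizedAtInfty g) :
    NormalizedAtInfty g⁻¹ := by
  set v := vInfty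
  set h : Matrix (Fin p ⊕ Fin q) (Fin p ⊕ Fin q) (RatFunc ℂ) := (g⁻¹ : RatGL p q).1 with hh
  have e : h - 1 = -((g.1 - 1) * h) := by
    have : g.1 * h = 1 := Units.mul_inv g
    rw [Matrix.sub_mul, this, Matrix.one_mul]; noncomm_ring
  have hle : ∀ i j, v (h i j) ≤ 1 := by
    intro i j
    obtain ⟨i₀, -, hmax⟩ := Finset.exists_max_image Finset.univ (fun k => v (h k j)) ⟨i, by simp⟩
    refine (hmax i (Finset.mem_univ _)).trans ?_
    by_contra! hlt
    have e1 : h i₀ j = -(∑ k, (g.1 - 1) i₀ k * h k j) +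
        (1 : Matrix (Fin p ⊕ Fin q) (Fin p ⊕ Fin q) (RatFunc ℂ)) i₀ j := by
      have := congrFun (congrFun e i₀) j
      rw [Matrix.sub_apply, Matrix.neg_apply, Matrix.mul_apply] at this
      rw [← this]; ring
    have h2 : v (-(∑ k, (g.1 - 1) i₀ k * h k j)) < v (h i₀ j) := by
      rw [Valuation.map_neg]
      refine v.map_sum_lt (zero_lt_one.trans hlt).ne' fun k _ => ?_
      rw [map_mul]
      have a := hg i₀ k
      have b := hmax k (Finset.mem_univ _)
      rcases eq_or_ne (v (h k j)) 0 with h0 | h0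
      · rw [h0, mul_zero]; exact zero_lt_one.trans hlt
      · refine lt_of_lt_of_le ?_ b
        have := mul_lt_mul_of_pos_right a (zero_lt_iff.2 h0)
        rwa [one_mul] at this
    have h3 : v ((1 : Matrix (Fin p ⊕ Fin q) (Fin p ⊕ Fin q) (RatFunc ℂ)) i₀ j) < v (h i₀ j) := by
      refine lt_of_le_of_lt ?_ hlt
      rw [Matrix.one_apply]; split_ifs <;> simp
    have h4 := v.map_add_lt h2 h3
    rw [← e1] at h4
    exact lt_irrefl _ h4
  intro i j
  have e1 := congrFun (congrFun e i) j
  rw [Matrix.sub_apply, Matrix.neg_apply, Matrix.mul_apply] at e1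
  rw [e1, Valuation.map_neg]
  refine v.map_sum_lt one_ne_zero fun k _ => ?_
  rw [map_mul]
  exact mul_lt_one_of_lt_of_le (hg i k) (hle k j)

lemma realityUpq_iff {p q : ℕ} (g : RatGL p q) : RealityUpq g ↔ loopStar g.1 * g.1 = 1 := by
  have hu : IsUnit (loopStar g.1) := by
    refine IsUnit.of_mul_eq_one (loopStar (g⁻¹).1) ?_
    rw [← loopStar_mul, ← Units.val_mul, inv_mul_cancel, Units.val_one, loopStar_one]
  have hd := (Matrix.isUnit_iff_isUnit_det _).1 hu
  constructor
  · intro h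
    unfold RealityUpq at h
    nth_rewrite 2 [← h]
    exact Matrix.mul_nonsing_inv _ hd
  · intro h
    exact Matrix.inv_eq_right_inv h

/-- The rational loop group `L⁻ U_{p,q}`. -/
def rationalLoopGroup (p q : ℕ) : Subgroup (RatGL p q) where
  carrier := {g | NormalizedAtInfty g ∧ RealityUpq g}
  one_mem' := by
    refine ⟨fun i j => ?_, (realityUpq_iff _).2 ?_⟩
    · simp
    · simp [loopStar_one]
  mul_mem' := by
    rintro a b ⟨ha, ha'⟩ ⟨hb, hb'⟩
    refine ⟨ha.mul hb, (realityUpq_iff _).2 ?_⟩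
    rw [realityUpq_iff] at ha' hb'
    rw [Units.val_mul, loopStar_mul, Matrix.mul_assoc, ← Matrix.mul_assoc (loopStar a.1), ha',
      Matrix.one_mul, hb']
  inv_mem' := by
    rintro a ⟨ha, ha'⟩
    refine ⟨ha.inv, (realityUpq_iff _).2 ?_⟩
    rw [realityUpq_iff] at ha'
    have h1 : loopStar (a⁻¹).1 * loopStar a.1 = 1 := by
      rw [← loopStar_mul, ← Units.val_mul, mul_inv_cancel, Units.val_one, loopStar_one]
    have h2 : loopStar a.1 = (a⁻¹).1 := by
      calc loopStar a.1 = loopStar a.1 * (a.1 * (a⁻¹).1) := by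
            rw [← Units.val_mul, mul_inv_cancel, Units.val_one, Matrix.mul_one]
        _ = (a⁻¹).1 := by rw [← Matrix.mul_assoc, ha', Matrix.one_mul]
    rw [h2] at h1
    exact h1

/-! ### The projective loops -/

/-- The rational function `(λ - a) / (λ - b)`. -/
def frac (a b : ℂ) : RatFunc ℂ := (RatFunc.X - RatFunc.C a) / (RatFunc.X - RatFunc.C b)

lemma X_sub_C_ne_zero (a : ℂ) : (RatFunc.X - RatFunc.C a : RatFunc ℂ) ≠ 0 := by
  rw [← RatFunc.algebraMap_X, ← RatFunc.algebraMap_C, ← map_sub]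
  exact RatFunc.algebraMap_ne_zero (Polynomial.X_sub_C_ne_zero a)

lemma frac_mul_frac (a b : ℂ) : frac a b * frac b a = 1 := by
  have ha := X_sub_C_ne_zero a
  have hb := X_sub_C_ne_zero b
  unfold frac
  field_simp

/-- The constant loop with value the matrix of the projection of `ℂⁿ` onto `A` along `B`, where
`ℂⁿ = A ⊕ B`. -/
def projMat {p q : ℕ} (A B : Submodule ℂ (Vec p q)) (h : IsCompl A B) :
    Matrix (Fin p ⊕ Fin q) (Fin p ⊕ Fin q) (RatFunc ℂ) :=
  (LinearMap.toMatrix' (A.projection B h)).map RatFunc.C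

lemma projMat_mul_self {p q : ℕ} {A B : Submodule ℂ (Vec p q)} (h : IsCompl A B) :
    projMat A B h * projMat A B h = projMat A B h := by
  rw [projMat, ← Matrix.map_mul, ← LinearMap.toMatrix'_mul]
  congr 2
  exact Submodule.isIdempotentElem_projection h

lemma projMat_mul_eq_zero {p q : ℕ} {A B A' B' : Submodule ℂ (Vec p q)} (h : IsCompl A B)
    (h' : IsCompl A' B') (hle : A' ≤ B) : projMat A B h * projMat A' B' h' = 0 := by
  rw [projMat, projMat, ← Matrix.map_mul, ← LinearMap.toMatrix'_mul]
  have : A.projection B h * A'.projection B' h' = 0 := by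
    refine LinearMap.ext fun x => ?_
    exact (Submodule.projection_apply_eq_zero_iff h).2
      (hle (Submodule.projection_apply_mem h' _))
  rw [this, map_zero, Matrix.map_zero _ (map_zero _)]

/-- The projective loop
`p_{α,L}(λ) = ((λ - α) / (λ - conj α)) π_L + π_{L^⊥}`
for a non-isotropic line `L`, with the projections belonging to `ℂⁿ = L ⊕ L^⊥`. -/
def pLoop {p q : ℕ} (α : ℂ) (L : Submodule ℂ (Vec p q)) (hL : IsLine L) (h : ¬ Isotropic L) :
    RatGL p q :=
  let P := projMat L (perp L) (isCompl_perp hL h)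
  let Q := projMat (perp L) L (isCompl_perp hL h).symm
  have hPQ : P * Q = 0 := projMat_mul_eq_zero _ _ le_rfl
  have hQP : Q * P = 0 := projMat_mul_eq_zero _ _ le_rfl
  have hP : P * P = P := projMat_mul_self _
  have hQ : Q * Q = Q := projMat_mul_self _
  have hsum : P + Q = 1 := by
    rw [← Matrix.map_one RatFunc.C (map_zero _) (map_one _), ← LinearMap.toMatrix'_id,
      ← Submodule.projection_add_projection_eq_id (isCompl_perp hL h), map_add,
      Matrix.map_add _ (map_add _)]
    rfl
  have key : ∀ a b : RatFunc ℂ, a * b = 1 → (a • P + Q) * (b • P + Q) = 1 := by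
    intro a b hab
    simp only [add_mul, mul_add, smul_mul_assoc, mul_smul_comm, hPQ, hQP, hP, hQ, smul_zero,
      add_zero, zero_add, smul_smul, mul_comm b a, hab, one_smul, hsum]
  { val := frac α (starRingEnd ℂ α) • P + Q
    inv := frac (starRingEnd ℂ α) α • P + Q
    val_inv := key _ _ (frac_mul_frac _ _)
    inv_val := key _ _ (frac_mul_frac _ _) }

/-- The projective loop
`g_{α,β,L,K,W}(λ) = ((λ - α) / (λ - β)) π_L + ((λ - conj β) / (λ - conj α)) π_K + π_W`
for isotropic lines `L`, `K` in general position and `W = L^⊥ ∩ K^⊥`, with the projections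
belonging to `ℂⁿ = L ⊕ K ⊕ W`. -/
def gLoop {p q : ℕ} (α β : ℂ) (L K : Submodule ℂ (Vec p q)) (hL : IsLine L) (hK : IsLine K)
    (iL : Isotropic L) (iK : Isotropic K) (h : GeneralPosition L K) : RatGL p q :=
  let P := projMat L (K ⊔ third L K) (isCompl_line hL hK iL iK h)
  let R := projMat K (L ⊔ third L K)
    (third_comm K L ▸ isCompl_line hK hL iK iL h.symm)
  let Q := projMat (third L K) (L ⊔ K) (isCompl_third hL hK iL iK h)
  have hP : P * P = P := projMat_mul_self _
  have hR : R * R = R := projMat_mul_self _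
  have hQ : Q * Q = Q := projMat_mul_self _
  have hPR : P * R = 0 := projMat_mul_eq_zero _ _ le_sup_left
  have hPQ : P * Q = 0 := projMat_mul_eq_zero _ _ le_sup_right
  have hRP : R * P = 0 := projMat_mul_eq_zero _ _ le_sup_left
  have hRQ : R * Q = 0 := projMat_mul_eq_zero _ _ le_sup_right
  have hQP : Q * P = 0 := projMat_mul_eq_zero _ _ le_sup_left
  have hQR : Q * R = 0 := projMat_mul_eq_zero _ _ le_sup_right
  have hsum : P + R + Q = 1 := by
    have hT : L.projection (K ⊔ third L K) (isCompl_line hL hK iL iK h) +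
        K.projection (L ⊔ third L K) (third_comm K L ▸ isCompl_line hK hL iK iL h.symm) +
        (third L K).projection (L ⊔ K) (isCompl_third hL hK iL iK h) = LinearMap.id := by
      refine LinearMap.ext fun x => ?_
      have hx : x ∈ L ⊔ (K ⊔ third L K) := by
        rw [(isCompl_line hL hK iL iK h).sup_eq_top]; exact Submodule.mem_top
      obtain ⟨l, hl, y, hy, rfl⟩ := Submodule.mem_sup.1 hx
      obtain ⟨k, hk, t, ht, rfl⟩ := Submodule.mem_sup.1 hy
      simp only [LinearMap.add_apply, map_add, LinearMap.id_apply]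
      rw [Submodule.projection_apply_of_mem_left _ hl, Submodule.projection_apply_of_mem_left _ hk,
        Submodule.projection_apply_of_mem_left _ ht,
        (Submodule.projection_apply_eq_zero_iff _).2 (Submodule.mem_sup_left hl),
        (Submodule.projection_apply_eq_zero_iff _).2 (Submodule.mem_sup_left hl),
        (Submodule.projection_apply_eq_zero_iff _).2 (Submodule.mem_sup_left hk),
        (Submodule.projection_apply_eq_zero_iff _).2 (Submodule.mem_sup_right hk),
        (Submodule.projection_apply_eq_zero_iff _).2 (Submodule.mem_sup_right ht),
        (Submodule.projection_apply_eq_zero_iff _).2 (Submodule.mem_sup_right ht)]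
      abel
    rw [← Matrix.map_one RatFunc.C (map_zero _) (map_one _), ← LinearMap.toMatrix'_id, ← hT,
      map_add, map_add, Matrix.map_add _ (map_add _), Matrix.map_add _ (map_add _)]
    rfl
  have key : ∀ a b c d : RatFunc ℂ, a * b = 1 → c * d = 1 →
      (a • P + c • R + Q) * (b • P + d • R + Q) = 1 := by
    intro a b c d hab hcd
    simp only [add_mul, mul_add, smul_mul_assoc, mul_smul_comm, hP, hR, hQ, hPR, hPQ, hRP, hRQ,
      hQP, hQR, smul_zero, add_zero, zero_add, smul_smul, mul_comm b a, mul_comm d c, hab, hcd,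
      one_smul, hsum]
  { val := frac α β • P + frac (starRingEnd ℂ β) (starRingEnd ℂ α) • R + Q
    inv := frac β α • P + frac (starRingEnd ℂ α) (starRingEnd ℂ β) • R + Q
    val_inv := key _ _ _ _ (frac_mul_frac _ _) (frac_mul_frac _ _)
    inv_val := key _ _ _ _ (frac_mul_frac _ _) (frac_mul_frac _ _) }

/-- The set of all loops `p_{α,L}`. -/
def pLoops (p q : ℕ) : Set (RatGL p q) :=
  {γ | ∃ (α : ℂ) (L : Submodule ℂ (Vec p q)) (hL : IsLine L) (h : ¬ Isotropic L),
    γ = pLoop α L hL h}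

/-- The set of all loops `g_{α,β,L,K,W}`. -/
def gLoops (p q : ℕ) : Set (RatGL p q) :=
  {γ | ∃ (α β : ℂ) (L K : Submodule ℂ (Vec p q)) (hL : IsLine L) (hK : IsLine K)
    (iL : Isotropic L) (iK : Isotropic K) (h : GeneralPosition L K),
    γ = gLoop α β L K hL hK iL iK h}

end LoopUpq

end

noncomputable section

namespace LoopUpq

open Matrix

variable {p q : ℕ}

/-! ### Conjugation and the place at infinity -/

/-! Extend the form to a Hermitian form over `RatFunc ℂ`, with the involution that conjugates
coefficients and fixes the variable. The loop group then consists of the isometries congruent to the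
identity at infinity, and generation is proved by Gaussian elimination in this unitary group, using
only transformations that are trivial at infinity.

On a constant hyperbolic pair `e`, `f` (isotropic, `⟨f, e⟩ = 1`), a loop of the second family is the
torus element `e ↦ a e`, `f ↦ (conj a)⁻¹ f` with `a = (λ - α) / (λ - β)`. Over `ℂ` every rational
`a` with `a(∞) = 1` is a product of such fractions, so all normalized torus elements are generated
(`HyperbolicPair.generated_torus`). Commutators of torus elements with constant unipotent isometries
give Siegel transformations, and products of these give every Siegel transformation with data
vanishing at infinity (`HyperbolicPair.generated_siegel`).

For `g` in the group, the `e`-coordinate of `g e` is 1 at infinity, hence invertible, so a torus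
element followed by a Siegel transformation carries `e` to `g e` (`HyperbolicPair.exists_fix_left`).
Doing this for `e` and then for `f` makes `g` fix the whole hyperbolic plane
(`HyperbolicPair.exists_fix`). Since both signs occur, the basis vectors can be treated in pairs of
opposite sign until `g` becomes the identity (`mem_closure_of_fix`). The first family enters only
through its membership in the group; elimination needs the second family alone. -/

lemma conjRat_C (a : ℂ) : conjRat (RatFunc.C a) = RatFunc.C (starRingEnd ℂ a) := by
  have h := RatFunc.map_apply_div (Polynomial.mapRingHom (starRingEnd ℂ))
    (nonZeroDivisors_le_comap_nonZeroDivisors_of_injective _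
      (Polynomial.map_injective _ (starRingEnd ℂ).injective)) (Polynomial.C a) 1
  rw [conjRat, RatFunc.coe_mapRingHom_eq_coe_map]
  simpa using h

lemma conjRat_X : conjRat RatFunc.X = RatFunc.X := by
  have h := RatFunc.map_apply_div (Polynomial.mapRingHom (starRingEnd ℂ))
    (nonZeroDivisors_le_comap_nonZeroDivisors_of_injective _
      (Polynomial.map_injective _ (starRingEnd ℂ).injective)) Polynomial.X 1
  rw [conjRat, RatFunc.coe_mapRingHom_eq_coe_map]
  simpa using h

lemma conjRat_frac (a b : ℂ) :
    conjRat (frac a b) = frac (starRingEnd ℂ a) (starRingEnd ℂ b) := by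
  simp [frac, conjRat_C, conjRat_X]

lemma conjRat_algebraMap (P : Polynomial ℂ) :
    conjRat (algebraMap _ _ P) = algebraMap _ _ (P.map (starRingEnd ℂ)) := by
  have h := RatFunc.map_apply_div (Polynomial.mapRingHom (starRingEnd ℂ))
    (nonZeroDivisors_le_comap_nonZeroDivisors_of_injective _
      (Polynomial.map_injective _ (starRingEnd ℂ).injective)) P 1
  rw [conjRat, RatFunc.coe_mapRingHom_eq_coe_map]
  simpa using h

@[simp] lemma conjRat_conjRat (f : RatFunc ℂ) : conjRat (conjRat f) = f := by
  have key : ∀ P Q : Polynomial ℂ, conjRat (conjRat (algebraMap _ _ P / algebraMap _ _ Q)) =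
      algebraMap _ _ P / algebraMap _ _ Q := by
    intro P Q
    simp [conjRat_algebraMap, Polynomial.map_map]
  simpa only [RatFunc.num_div_denom] using key f.num f.denom

lemma vInfty_C_le (a : ℂ) : vInfty (RatFunc.C a) ≤ 1 := by
  rcases eq_or_ne a 0 with rfl | h
  · simp
  · classical
    exact (RatFunc.inftyValuation.C ℂ h).le

lemma vInfty_div_polynomial_lt_iff {P Q : Polynomial ℂ} (hQ : Q ≠ 0) :
    vInfty (algebraMap _ _ P / algebraMap _ _ Q) < 1 ↔ P.degree < Q.degree := by
  classical
  rcases eq_or_ne P 0 with rfl | hP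
  · simp [bot_lt_iff_ne_bot, hQ]
  rw [map_div₀]
  have e : ∀ R : Polynomial ℂ, R ≠ 0 → vInfty (algebraMap _ _ R) = WithZero.exp (R.natDegree : ℤ) := by
    intro R hR
    rw [← RatFunc.inftyValuation.polynomial ℂ hR, vInfty, RatFunc.inftyValuation_apply]
  rw [e P hP, e Q hQ, ← WithZero.exp_sub, ← WithZero.exp_zero, WithZero.exp_lt_exp,
    Polynomial.degree_eq_natDegree hP, Polynomial.degree_eq_natDegree hQ, Nat.cast_lt]
  omega

lemma vInfty_frac_sub_one (a b : ℂ) : vInfty (frac a b - 1) < 1 := by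
  have e : frac a b - 1 =
      algebraMap _ _ (Polynomial.C (b - a)) / algebraMap _ _ (Polynomial.X - Polynomial.C b) := by
    have hb := X_sub_C_ne_zero b
    rw [frac, div_sub_one hb]
    simp
  rw [e]
  refine (vInfty_div_polynomial_lt_iff (Polynomial.X_sub_C_ne_zero b)).2 ?_
  rw [Polynomial.degree_X_sub_C]
  exact lt_of_le_of_lt Polynomial.degree_C_le (by norm_num)

/-! ### The Hermitian form over the field of rational functions -/

/-- The Hermitian extension of `form` to vectors of rational functions. -/
def ratForm (p q : ℕ) :
    (Fin p ⊕ Fin q → RatFunc ℂ) →ₛₗ[conjRat] (Fin p ⊕ Fin q → RatFunc ℂ) →ₗ[RatFunc ℂ] RatFunc ℂ :=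
  LinearMap.mk₂'ₛₗ conjRat (RingHom.id _)
    (fun v w => (fun i => conjRat (v i)) ⬝ᵥ (sgn p q _ *ᵥ w))
    (by intro v v' w
        simp only [Pi.add_apply, map_add, ← add_dotProduct]; rfl)
    (by intro c v w
        rw [← smul_dotProduct]; congr 1; funext i; simp)
    (by intro v w w'
        simp only [mulVec_add, dotProduct_add])
    (by intro c v w
        simp only [mulVec_smul, dotProduct_smul, RingHom.id_apply])

lemma ratForm_apply (v w : Fin p ⊕ Fin q → RatFunc ℂ) :
    ratForm p q v w = (fun i => conjRat (v i)) ⬝ᵥ (sgn p q _ *ᵥ w) := rfl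

lemma ratForm_eq_sum (v w : Fin p ⊕ Fin q → RatFunc ℂ) :
    ratForm p q v w = ∑ i, conjRat (v i) * (Sum.elim (fun _ => -1) (fun _ => 1) i * w i) := by
  simp only [ratForm_apply, sgn, dotProduct, mulVec_diagonal]

lemma conjRat_ratForm (v w : Fin p ⊕ Fin q → RatFunc ℂ) :
    conjRat (ratForm p q v w) = ratForm p q w v := by
  simp only [ratForm_eq_sum, map_sum, map_mul, conjRat_conjRat]
  refine Finset.sum_congr rfl fun i _ => ?_
  rcases i with i | i <;> simp [mul_comm]

/-- A constant vector, as a vector of rational functions. -/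
def constVec (v : Vec p q) : Fin p ⊕ Fin q → RatFunc ℂ := fun i => RatFunc.C (v i)

@[simp] lemma constVec_add (v w : Vec p q) : constVec (v + w) = constVec v + constVec w := by
  funext i; simp [constVec]

@[simp] lemma constVec_sub (v w : Vec p q) : constVec (v - w) = constVec v - constVec w := by
  funext i; simp [constVec]

@[simp] lemma constVec_smul (c : ℂ) (v : Vec p q) :
    constVec (c • v) = RatFunc.C c • constVec v := by
  funext i; simp [constVec]

@[simp] lemma constVec_zero : constVec (0 : Vec p q) = 0 := by
  funext i; simp [constVec]

@[simp] lemma constVec_single (i : Fin p ⊕ Fin q) :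
    constVec (Pi.single i 1) = Pi.single i 1 := by
  funext j
  rcases eq_or_ne j i with rfl | h <;> simp [constVec, *]

lemma map_C_mulVec_constVec (A : Matrix (Fin p ⊕ Fin q) (Fin p ⊕ Fin q) ℂ) (v : Vec p q) :
    A.map RatFunc.C *ᵥ constVec v = constVec (A *ᵥ v) := by
  funext i; simp [constVec, mulVec, dotProduct]

@[simp] lemma ratForm_constVec (v w : Vec p q) :
    ratForm p q (constVec v) (constVec w) = RatFunc.C (form p q v w) := by
  simp [ratForm_eq_sum, constVec, conjRat_C, form]

lemma vInfty_ratForm_lt (v : Vec p q) {x : Fin p ⊕ Fin q → RatFunc ℂ} (hx : ∀ i, vInfty (x i) < 1) :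
    vInfty (ratForm p q (constVec v) x) < 1 := by
  rw [ratForm_eq_sum]
  refine vInfty.map_sum_lt one_ne_zero fun i _ => ?_
  rw [constVec, conjRat_C, map_mul, map_mul]
  rw [mul_comm]
  refine mul_lt_one_of_lt_of_le ?_ (vInfty_C_le _)
  rcases i with i | i <;> simp [hx, Valuation.map_neg]

lemma ratForm_mulVec_left (A : Matrix (Fin p ⊕ Fin q) (Fin p ⊕ Fin q) (RatFunc ℂ))
    (x y : Fin p ⊕ Fin q → RatFunc ℂ) :
    ratForm p q (A *ᵥ x) y = ratForm p q x (loopStar A *ᵥ y) := by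
  have e : (fun i => conjRat ((A *ᵥ x) i)) = A.map conjRat *ᵥ (fun i => conjRat (x i)) := by
    funext i; simp [mulVec, dotProduct]
  rw [ratForm_apply, ratForm_apply, e, loopStar, mulVec_mulVec, Matrix.mul_assoc,
    ← Matrix.mul_assoc, sgn_mul_sgn, Matrix.one_mul, ← mulVec_mulVec, mulVec_transpose,
    dotProduct_comm, dotProduct_mulVec, dotProduct_comm]

lemma ratForm_single (i : Fin p ⊕ Fin q) (y : Fin p ⊕ Fin q → RatFunc ℂ) :
    ratForm p q (Pi.single i 1) y = Sum.elim (fun _ => -1) (fun _ => 1) i * y i := by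
  rw [ratForm_eq_sum, Finset.sum_eq_single i]
  · simp
  · intro j _ h; simp [h]
  · simp

lemma ratForm_nondegenerate {y : Fin p ⊕ Fin q → RatFunc ℂ} (h : ∀ x, ratForm p q x y = 0) :
    y = 0 := by
  funext i
  have := h (Pi.single i 1)
  rw [ratForm_single] at this
  rcases i with i | i <;> simpa using this

/-- `loopStar` is the adjoint for `ratForm`, so reality is the isometry condition; the converse
direction uses nondegeneracy. -/
lemma realityUpq_iff_ratForm (g : RatGL p q) :
    RealityUpq g ↔ ∀ x y, ratForm p q (g.1 *ᵥ x) (g.1 *ᵥ y) = ratForm p q x y := by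
  rw [realityUpq_iff]
  constructor
  · intro h x y
    rw [ratForm_mulVec_left, mulVec_mulVec, h, one_mulVec]
  · intro h
    refine Matrix.ext_of_mulVec_single fun i => ?_
    rw [one_mulVec, ← sub_eq_zero]
    refine ratForm_nondegenerate fun x => ?_
    rw [map_sub, ← mulVec_mulVec, ← ratForm_mulVec_left, h, sub_self]

lemma normalizedAtInfty_iff (g : RatGL p q) :
    NormalizedAtInfty g ↔ ∀ v : Vec p q, ∀ i, vInfty ((g.1 *ᵥ constVec v - constVec v) i) < 1 := by
  constructor
  · intro h v i
    have e : g.1 *ᵥ constVec v - constVec v = (g.1 - 1) *ᵥ constVec v := by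
      rw [sub_mulVec, one_mulVec]
    rw [e, mulVec, dotProduct]
    refine vInfty.map_sum_lt one_ne_zero fun j _ => ?_
    rw [map_mul]
    exact mul_lt_one_of_lt_of_le (h i j) (vInfty_C_le _)
  · intro h i j
    have := h (Pi.single j 1) i
    rw [constVec_single] at this
    simpa [Matrix.one_apply, Pi.single_apply] using this

/-! ### The action of the generators -/

lemma projMat_mulVec_constVec {A B : Submodule ℂ (Vec p q)} (h : IsCompl A B) {v w : Vec p q}
    (hw : w ∈ A) (hvw : v - w ∈ B) : projMat A B h *ᵥ constVec v = constVec w := by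
  rw [projMat, map_C_mulVec_constVec, LinearMap.toMatrix'_mulVec]
  congr 1
  calc A.projection B h v = A.projection B h w + A.projection B h (v - w) := by
        rw [← map_add]; congr 1; abel
    _ = w := by
      rw [Submodule.projection_apply_of_mem_left h hw,
        (Submodule.projection_apply_eq_zero_iff h).2 hvw, add_zero]

/-- Constant vectors contain the standard basis, so they determine a linear map. The projections are
defined over `ℂ` and can therefore be computed on constant vectors only. -/
lemma mulVec_eq_of_constVec {A : Matrix (Fin p ⊕ Fin q) (Fin p ⊕ Fin q) (RatFunc ℂ)}
    {T : (Fin p ⊕ Fin q → RatFunc ℂ) →ₗ[RatFunc ℂ] (Fin p ⊕ Fin q → RatFunc ℂ)}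
    (H : ∀ v : Vec p q, A *ᵥ constVec v = T (constVec v)) (x) : A *ᵥ x = T x := by
  have e : A = LinearMap.toMatrix' T := by
    refine Matrix.ext_of_mulVec_single fun i => ?_
    rw [LinearMap.toMatrix'_mulVec, ← constVec_single, H]
  rw [e, LinearMap.toMatrix'_mulVec]

/-- `e`, `f` are isotropic vectors with `⟨f, e⟩ = 1`. -/
structure HyperbolicPair (e f : Vec p q) : Prop where
  left : form p q e e = 0
  right : form p q f f = 0
  right_left : form p q f e = 1

namespace HyperbolicPair

variable {e f : Vec p q} (H : HyperbolicPair e f)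
include H

lemma left_right : form p q e f = 1 := by
  rw [← form_symm, H.right_left, map_one]

lemma symm : HyperbolicPair f e := ⟨H.right, H.left, H.left_right⟩

lemma left_ne_zero : e ≠ 0 := by
  rintro rfl
  simpa using H.right_left

lemma right_ne_zero : f ≠ 0 := H.symm.left_ne_zero

lemma ratForm_left : ratForm p q (constVec e) (constVec e) = 0 := by simp [H.left]

lemma ratForm_right : ratForm p q (constVec f) (constVec f) = 0 := by simp [H.right]

lemma ratForm_right_left : ratForm p q (constVec f) (constVec e) = 1 := by simp [H.right_left]

lemma ratForm_left_right : ratForm p q (constVec e) (constVec f) = 1 := by simp [H.left_right]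

end HyperbolicPair

/-- The diagonal transformation `e ↦ a e`, `f ↦ (conj a)⁻¹ f` of a hyperbolic pair, fixing
the orthogonal complement of the pair. -/
def torus (e f : Vec p q) (a : RatFunc ℂ) :
    (Fin p ⊕ Fin q → RatFunc ℂ) →ₗ[RatFunc ℂ] (Fin p ⊕ Fin q → RatFunc ℂ) :=
  LinearMap.id + (a - 1) • (ratForm p q (constVec f)).smulRight (constVec e) +
    ((conjRat a)⁻¹ - 1) • (ratForm p q (constVec e)).smulRight (constVec f)

lemma torus_apply (e f : Vec p q) (a : RatFunc ℂ) (x) :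
    torus e f a x = x + ((a - 1) * ratForm p q (constVec f) x) • constVec e +
      (((conjRat a)⁻¹ - 1) * ratForm p q (constVec e) x) • constVec f := by
  simp [torus, smul_smul]

lemma HyperbolicPair.torus_mul {e f : Vec p q} (H : HyperbolicPair e f) {a b : RatFunc ℂ} (x) :
    torus e f a (torus e f b x) = torus e f (a * b) x := by
  simp only [torus_apply, map_add, map_smul, H.ratForm_left, H.ratForm_right, H.ratForm_right_left,
    H.ratForm_left_right, map_mul, mul_inv]
  funext i
  simp only [Pi.add_apply, Pi.smul_apply, smul_eq_mul]
  ring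

lemma torus_one (e f : Vec p q) (x) : torus e f 1 x = x := by simp [torus_apply]

lemma HyperbolicPair.ratForm_torus {e f : Vec p q} (H : HyperbolicPair e f) {a : RatFunc ℂ}
    (ha : a ≠ 0) (x y) : ratForm p q (torus e f a x) (torus e f a y) = ratForm p q x y := by
  have ha' : conjRat a ≠ 0 := (map_ne_zero _).2 ha
  simp only [torus_apply, map_add, map_smul, map_smulₛₗ, LinearMap.add_apply, LinearMap.smul_apply,
    H.ratForm_left, H.ratForm_right, H.ratForm_right_left,
    H.ratForm_left_right, smul_eq_mul, map_mul, map_sub, map_inv₀, map_one, conjRat_ratForm,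
    conjRat_conjRat]
  field_simp
  ring

lemma frac_ne_zero (a b : ℂ) : frac a b ≠ 0 := left_ne_zero_of_mul_eq_one (frac_mul_frac a b)

lemma frac_inv (a b : ℂ) : (frac a b)⁻¹ = frac b a :=
  inv_eq_of_mul_eq_one_right (frac_mul_frac a b)

/-- The coefficient on `K` is `(conj a)⁻¹` for `a = frac α β`, exactly what preserving the pairing
of `L` with `K` demands; the loop is thus a torus element. -/
lemma gLoop_mulVec {α β : ℂ} {L K : Submodule ℂ (Vec p q)} (hL : IsLine L) (hK : IsLine K)
    (iL : Isotropic L) (iK : Isotropic K) (h : GeneralPosition L K) {e f : Vec p q}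
    (H : HyperbolicPair e f) (he : e ∈ L) (hf : f ∈ K) (x) :
    (gLoop α β L K hL hK iL iK h).1 *ᵥ x = torus e f (frac α β) x := by
  have key : ∀ {M : Submodule ℂ (Vec p q)} {u : Vec p q}, IsLine M → u ∈ M → u ≠ 0 →
      ∀ y ∈ M, ∃ c : ℂ, c • u = y := fun hM hu hu0 y hy => by
    obtain ⟨c, hc⟩ := exists_smul_eq_of_finrank_eq_one hM (x := ⟨_, hu⟩) (by simpa using hu0) ⟨y, hy⟩
    exact ⟨c, congrArg Subtype.val hc⟩
  have kL := key hL he H.left_ne_zero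
  have kK := key hK hf H.right_ne_zero
  refine mulVec_eq_of_constVec (fun v => ?_) x
  -- In a hyperbolic pair the coordinate along `e` is `⟨f, v⟩` and the one along `f` is `⟨e, v⟩`;
  -- the remainder lies in `W`.
  have hthird : v - form p q f v • e - form p q e v • f ∈ third L K := by
    refine ⟨fun y hy => ?_, fun y hy => ?_⟩
    · obtain ⟨c, rfl⟩ := kL y hy
      simp [H.left, H.left_right]
    · obtain ⟨c, rfl⟩ := kK y hy
      simp [H.right, H.right_left]
  have hP : projMat L (K ⊔ third L K) (isCompl_line hL hK iL iK h) *ᵥ constVec v =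
      constVec (form p q f v • e) := by
    refine projMat_mulVec_constVec _ (L.smul_mem _ he) (Submodule.mem_sup.2
      ⟨_, K.smul_mem (form p q e v) hf, _, hthird, by abel⟩)
  have hR : projMat K (L ⊔ third L K) (third_comm K L ▸ isCompl_line hK hL iK iL h.symm) *ᵥ
      constVec v = constVec (form p q e v • f) := by
    refine projMat_mulVec_constVec _ (K.smul_mem _ hf) (Submodule.mem_sup.2
      ⟨_, L.smul_mem (form p q f v) he, _, hthird, by abel⟩)
  have hQ : projMat (third L K) (L ⊔ K) (isCompl_third hL hK iL iK h) *ᵥ constVec v =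
      constVec (v - form p q f v • e - form p q e v • f) := by
    refine projMat_mulVec_constVec _ hthird (Submodule.mem_sup.2
      ⟨_, L.smul_mem (form p q f v) he, _, K.smul_mem (form p q e v) hf, by abel⟩)
  simp only [gLoop, add_mulVec, smul_mulVec, hP, hR, hQ, torus_apply, conjRat_frac, frac_inv,
    constVec_sub, constVec_smul, ratForm_constVec]
  funext i
  simp only [Pi.add_apply, Pi.sub_apply, Pi.smul_apply, smul_eq_mul]
  ring

/-- Lines spanned by the two members of a hyperbolic pair give a projective loop. -/
lemma HyperbolicPair.exists_gLoop {e f : Vec p q} (H : HyperbolicPair e f) (α β : ℂ) :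
    ∃ γ ∈ gLoops p q, ∀ x, γ.1 *ᵥ x = torus e f (frac α β) x := by
  have iso : ∀ u : Vec p q, form p q u u = 0 → Isotropic (Submodule.span ℂ {u}) := by
    intro u hu v hv w hw
    obtain ⟨a, rfl⟩ := Submodule.mem_span_singleton.1 hv
    obtain ⟨b, rfl⟩ := Submodule.mem_span_singleton.1 hw
    simp [hu]
  have he := Submodule.mem_span_singleton_self (R := ℂ) e
  have hf := Submodule.mem_span_singleton_self (R := ℂ) f
  exact ⟨_, ⟨α, β, _, _, finrank_span_singleton H.left_ne_zero,
    finrank_span_singleton H.right_ne_zero, iso e H.left, iso f H.right,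
    ⟨e, he, f, hf, by simp [H.left_right]⟩, rfl⟩, gLoop_mulVec _ _ _ _ _ H he hf⟩

lemma GeneralPosition.exists_hyperbolicPair {L K : Submodule ℂ (Vec p q)}
    (iL : Isotropic L) (iK : Isotropic K) (h : GeneralPosition L K) :
    ∃ e f, HyperbolicPair e f ∧ e ∈ L ∧ f ∈ K := by
  obtain ⟨v, hv, w, hw, hvw⟩ := h.symm
  refine ⟨(form p q v w)⁻¹ • w, v, ⟨?_, iK v hv v hv, ?_⟩, L.smul_mem _ hw, hv⟩
  · simp [iL w hw w hw]
  · simp [hvw]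

lemma gLoops_subset : gLoops p q ⊆ rationalLoopGroup p q := by
  rintro _ ⟨α, β, L, K, hL, hK, iL, iK, h, rfl⟩
  obtain ⟨e, f, H, he, hf⟩ := h.exists_hyperbolicPair iL iK
  have hact := gLoop_mulVec (α := α) (β := β) hL hK iL iK h H he hf
  refine ⟨(normalizedAtInfty_iff _).2 fun v i => ?_, (realityUpq_iff_ratForm _).2 fun x y => ?_⟩
  · have hsmall : ∀ (a b : ℂ) (c d : ℂ), vInfty ((frac a b - 1) * RatFunc.C c * RatFunc.C d) < 1 := by
      intro a b c d
      rw [mul_assoc, ← map_mul, map_mul]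
      exact mul_lt_one_of_lt_of_le (vInfty_frac_sub_one a b) (vInfty_C_le _)
    rw [hact, torus_apply, conjRat_frac, frac_inv, add_assoc, add_sub_cancel_left]
    simp only [ratForm_constVec, Pi.add_apply, Pi.smul_apply, smul_eq_mul]
    exact vInfty.map_add_lt (hsmall _ _ _ _) (hsmall _ _ _ _)
  · rw [hact, hact, H.ratForm_torus (frac_ne_zero _ _)]

lemma pLoop_mulVec {α : ℂ} {L : Submodule ℂ (Vec p q)} (hL : IsLine L) (h : ¬ Isotropic L)
    {u : Vec p q} (hu : u ∈ L) (huu : form p q u u ≠ 0) (v : Vec p q) :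
    (pLoop α L hL h).1 *ᵥ constVec v = constVec v +
      ((frac α (starRingEnd ℂ α) - 1) * RatFunc.C (form p q u u)⁻¹ *
        ratForm p q (constVec u) (constVec v)) • constVec u := by
  have hu0 : u ≠ 0 := by rintro rfl; simp at huu
  have hperp : v - ((form p q u u)⁻¹ * form p q u v) • u ∈ perp L := by
    intro y hy
    obtain ⟨c, hc⟩ := exists_smul_eq_of_finrank_eq_one hL (x := ⟨u, hu⟩) (by simpa using hu0) ⟨y, hy⟩
    obtain rfl : c • u = y := congrArg Subtype.val hc
    simp only [map_sub, map_smul, map_smulₛₗ, LinearMap.smul_apply, smul_eq_mul]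
    field_simp
    ring
  have hm : ((form p q u u)⁻¹ * form p q u v) • u ∈ L := L.smul_mem _ hu
  have hP := projMat_mulVec_constVec (isCompl_perp hL h) hm hperp
  have hQ := projMat_mulVec_constVec (isCompl_perp hL h).symm (v := v) hperp (by simpa using hm)
  simp only [pLoop, add_mulVec, smul_mulVec, hP, hQ, constVec_sub, constVec_smul,
    ratForm_constVec, map_mul]
  funext i
  simp only [Pi.add_apply, Pi.sub_apply, Pi.smul_apply, smul_eq_mul]
  ring

lemma pLoops_subset : pLoops p q ⊆ rationalLoopGroup p q := by
  rintro _ ⟨α, L, hL, h, rfl⟩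
  obtain ⟨u, hu, huu⟩ : ∃ u ∈ L, form p q u u ≠ 0 := by
    have h' := h
    unfold Isotropic at h'
    push Not at h'
    obtain ⟨v, w, rfl, hw, hvw, -⟩ := GeneralPosition.exists_span hL hL h'
    have hv := Submodule.mem_span_singleton_self (R := ℂ) v
    refine ⟨v, hv, fun h0 => h fun x hx y hy => ?_⟩
    obtain ⟨a, rfl⟩ := Submodule.mem_span_singleton.1 hx
    obtain ⟨b, rfl⟩ := Submodule.mem_span_singleton.1 hy
    simp [h0]
  refine ⟨(normalizedAtInfty_iff _).2 fun v i => ?_, (realityUpq_iff_ratForm _).2 fun x y => ?_⟩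
  · rw [pLoop_mulVec hL h hu huu, add_sub_cancel_left]
    simp only [ratForm_constVec, Pi.smul_apply, smul_eq_mul, constVec, mul_assoc, ← map_mul]
    rw [map_mul]
    exact mul_lt_one_of_lt_of_le (vInfty_frac_sub_one _ _) (vInfty_C_le _)
  · have hact : ∀ x, (pLoop α L hL h).1 *ᵥ x = x +
        ((frac α (starRingEnd ℂ α) - 1) * RatFunc.C (form p q u u)⁻¹ *
          ratForm p q (constVec u) x) • constVec u := fun x => by
      rw [mulVec_eq_of_constVec (T := LinearMap.id +
        ((frac α (starRingEnd ℂ α) - 1) * RatFunc.C (form p q u u)⁻¹) •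
          (ratForm p q (constVec u)).smulRight (constVec u))]
      · simp [smul_smul]
      · intro v
        rw [pLoop_mulVec hL h hu huu]
        simp [smul_smul]
    have hd : RatFunc.C (form p q u u) ≠ 0 := by simpa using huu
    have hf := frac_ne_zero α (starRingEnd ℂ α)
    rw [hact, hact]
    simp only [map_add, map_smul, map_smulₛₗ, LinearMap.add_apply, LinearMap.smul_apply,
      ratForm_constVec, smul_eq_mul, map_mul, map_sub, map_inv₀, map_one, conjRat_ratForm,
      conjRat_frac, conjRat_C, form_symm, Complex.conj_conj]
    -- The coefficient is unitary: its conjugate `frac (conj α) α` is its inverse. With `⟨u, u⟩`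
    -- real, this gives the isometry property.
    rw [← frac_inv α (starRingEnd ℂ α)]
    field_simp
    ring

lemma closure_le_rationalLoopGroup :
    Subgroup.closure (pLoops p q ∪ gLoops p q) ≤ rationalLoopGroup p q :=
  (Subgroup.closure_le _).2 (Set.union_subset pLoops_subset gLoops_subset)

/-! ### Transformations realized by products of projective loops -/

/-- `T` is the action of a product of projective loops. -/
def Generated (T : (Fin p ⊕ Fin q → RatFunc ℂ) → (Fin p ⊕ Fin q → RatFunc ℂ)) : Prop :=
  ∃ γ ∈ Subgroup.closure (pLoops p q ∪ gLoops p q), ∀ x, γ.1 *ᵥ x = T x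

lemma Generated.comp {T T' : (Fin p ⊕ Fin q → RatFunc ℂ) → (Fin p ⊕ Fin q → RatFunc ℂ)}
    (h : Generated T) (h' : Generated T') : Generated (fun x => T (T' x)) := by
  obtain ⟨γ, hγ, e⟩ := h
  obtain ⟨γ', hγ', e'⟩ := h'
  exact ⟨γ * γ', mul_mem hγ hγ', fun x => by rw [Units.val_mul, ← mulVec_mulVec, e', e]⟩

lemma generated_id : Generated (p := p) (q := q) fun x => x :=
  ⟨1, one_mem _, fun x => by simp⟩

lemma vInfty_eq_one {a : RatFunc ℂ} (h : vInfty (a - 1) < 1) : vInfty a = 1 := by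
  have := vInfty.map_add_eq_of_lt_right (x := a - 1) (y := 1) (by simpa using h)
  simpa using this

lemma vInfty_inv_sub_one {a : RatFunc ℂ} (h : vInfty (a - 1) < 1) : vInfty (a⁻¹ - 1) < 1 := by
  have h1 := vInfty_eq_one h
  have ha : a ≠ 0 := by rintro rfl; simp at h1
  have e : a⁻¹ - 1 = -((a - 1) * a⁻¹) := by field_simp; ring
  rw [e, Valuation.map_neg, map_mul, map_inv₀, h1]
  simpa using h

/-- Numerator and denominator split into equally many linear factors; pairing them arbitrarily
writes the torus element as a product of loops of the second family. -/
lemma HyperbolicPair.generated_torus_div {e f : Vec p q} (H : HyperbolicPair e f) (n : ℕ) :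
    ∀ P Q : Polynomial ℂ, P.Monic → Q.Monic → P.natDegree = n → Q.natDegree = n →
      Generated (torus e f (algebraMap _ _ P / algebraMap _ _ Q)) := by
  induction n with
  | zero =>
    intro P Q hP hQ hPn hQn
    rw [hP.natDegree_eq_zero.1 hPn, hQ.natDegree_eq_zero.1 hQn]
    simpa [funext (torus_one e f)] using generated_id
  | succ n ih =>
    intro P Q hP hQ hPn hQn
    have key : ∀ R : Polynomial ℂ, R.Monic → R.natDegree = n + 1 →
        ∃ (a : ℂ) (R' : Polynomial ℂ), R'.Monic ∧ R'.natDegree = n ∧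
          R = (Polynomial.X - Polynomial.C a) * R' := by
      intro R hR hRn
      obtain ⟨a, ha⟩ := IsAlgClosed.exists_root R (by
        rw [Polynomial.degree_eq_natDegree hR.ne_zero, hRn]; exact_mod_cast n.succ_ne_zero)
      obtain ⟨R', rfl⟩ := Polynomial.dvd_iff_isRoot.2 ha
      have hR' := (Polynomial.monic_X_sub_C a).of_mul_monic_left hR
      refine ⟨a, R', hR', ?_, rfl⟩
      rw [(Polynomial.monic_X_sub_C a).natDegree_mul hR', Polynomial.natDegree_X_sub_C] at hRn
      omega
    obtain ⟨α, P, hP', hPn', rfl⟩ := key P hP hPn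
    obtain ⟨β, Q, hQ', hQn', rfl⟩ := key Q hQ hQn
    obtain ⟨γ, hγ, hact⟩ := H.exists_gLoop α β
    have h1 : Generated (torus e f (frac α β)) :=
      ⟨γ, Subgroup.subset_closure (Set.mem_union_right _ hγ), hact⟩
    have h2 := h1.comp (ih P Q hP' hQ' hPn' hQn')
    simp only [H.torus_mul] at h2
    convert h2 using 2
    simp only [map_mul, map_sub, RatFunc.algebraMap_X, RatFunc.algebraMap_C, frac]
    rw [mul_div_mul_comm]

lemma HyperbolicPair.generated_torus {e f : Vec p q} (H : HyperbolicPair e f) {a : RatFunc ℂ}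
    (ha : vInfty (a - 1) < 1) : Generated (torus e f a) := by
  have hQ := RatFunc.monic_denom a
  have hQ0 : algebraMap (Polynomial ℂ) (RatFunc ℂ) a.denom ≠ 0 :=
    RatFunc.algebraMap_ne_zero hQ.ne_zero
  have e : a - 1 = algebraMap _ _ (a.num - a.denom) / algebraMap _ _ a.denom := by
    rw [map_sub, sub_div, RatFunc.num_div_denom, div_self hQ0]
  rw [e, vInfty_div_polynomial_lt_iff hQ.ne_zero] at ha
  -- `num - denom` has degree below that of the monic `denom`, so `num` is monic of the same degree.
  have hP : a.num.Monic := by simpa using hQ.add_of_left ha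
  have hn : a.num.natDegree = a.denom.natDegree := by
    simpa using Polynomial.natDegree_add_eq_left_of_degree_lt ha
  simpa only [RatFunc.num_div_denom] using H.generated_torus_div _ _ _ hP hQ hn rfl

/-! ### Siegel transformations -/

/-- The Siegel transformation attached to an isotropic vector `f`: it fixes `f`, and maps `e` to
`e + y + c f` if `⟨f, e⟩ = 1` and `y` is orthogonal to `e`. -/
def siegel (f : Vec p q) (y : Fin p ⊕ Fin q → RatFunc ℂ) (c : RatFunc ℂ)
    (x : Fin p ⊕ Fin q → RatFunc ℂ) : Fin p ⊕ Fin q → RatFunc ℂ :=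
  x + ratForm p q (constVec f) x • (y + c • constVec f) - ratForm p q y x • constVec f

/-- A Heisenberg-type group law: the vectors `y` add, while the coefficients of `f` add up to a
twist by `⟨y, y'⟩`. Hence `y` can be assembled summand by summand, with the coefficient corrected
afterwards. -/
lemma siegel_siegel {f : Vec p q} (hf : form p q f f = 0) {y y' : Fin p ⊕ Fin q → RatFunc ℂ}
    (hy : ratForm p q (constVec f) y = 0) (hy' : ratForm p q (constVec f) y' = 0)
    (c c' : RatFunc ℂ) (x) :
    siegel f y c (siegel f y' c' x) = siegel f (y + y') (c + c' - ratForm p q y y') x := by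
  have hy1 : ratForm p q y (constVec f) = 0 := by rw [← conjRat_ratForm, hy, map_zero]
  simp only [siegel, map_add, map_sub, map_smul, LinearMap.add_apply, ratForm_constVec, hf, hy', hy1,
    smul_eq_mul, map_zero]
  funext i
  simp only [Pi.add_apply, Pi.sub_apply, Pi.smul_apply, smul_eq_mul]
  ring

lemma HyperbolicPair.siegel_left {e f : Vec p q} (H : HyperbolicPair e f)
    {y : Fin p ⊕ Fin q → RatFunc ℂ} (hy : ratForm p q (constVec e) y = 0) (c : RatFunc ℂ) :
    siegel f y c (constVec e) = constVec e + y + c • constVec f := by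
  have hy1 : ratForm p q y (constVec e) = 0 := by rw [← conjRat_ratForm, hy, map_zero]
  simp [siegel, H.right_left, hy1, add_assoc]

/-- Let `u` be the constant Siegel transformation with data `y`, `c`; condition `hc` makes it an
isometry. It is in general not normalized at infinity, but it carries the pair `(e, f)` to `(e + y +
c f, f)`. So conjugating a torus element `T` by `u` gives the torus element of another constant
pair, and the commutator `u T⁻¹ u⁻¹ T` is generated. For `T` with parameter `1 - t` it is the stated
Siegel transformation. -/
lemma HyperbolicPair.generated_siegel_smul {e f : Vec p q} (H : HyperbolicPair e f) {y : Vec p q}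
    (hey : form p q e y = 0) (hfy : form p q f y = 0) {c : ℂ}
    (hc : c + starRingEnd ℂ c + form p q y y = 0) {t : RatFunc ℂ} (ht : vInfty t < 1) :
    Generated (siegel f (t • constVec y)
      (t * RatFunc.C c - (1 - t) * conjRat t * RatFunc.C (starRingEnd ℂ c))) := by
  have hye : form p q y e = 0 := by rw [← form_symm, hey, map_zero]
  have hyf : form p q y f = 0 := by rw [← form_symm, hfy, map_zero]
  have H' : HyperbolicPair (e + y + c • f) f := by
    refine ⟨?_, H.right, ?_⟩
    · simp only [map_add, map_smul, map_smulₛₗ, LinearMap.add_apply, LinearMap.smul_apply, H.left,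
        H.right, H.right_left, H.left_right, hey, hfy, hye, hyf, smul_eq_mul]
      linear_combination hc
    · simp [H.right, H.right_left, hfy]
  have ha' : vInfty ((1 - t) - 1) < 1 := by simpa using ht
  have ha0 : 1 - t ≠ 0 := fun h => by simp [h] at ha'
  have hb0 : 1 - conjRat t ≠ 0 := by simpa using (map_ne_zero conjRat).2 ha0
  obtain ⟨γ, hγ, hact⟩ := (H'.generated_torus (vInfty_inv_sub_one ha')).comp
    (H.generated_torus ha')
  refine ⟨γ, hγ, fun x => ?_⟩
  rw [hact]
  simp only [torus_apply, siegel, constVec_add, constVec_smul, map_add, map_smul, map_smulₛₗ,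
    LinearMap.add_apply, LinearMap.smul_apply, ratForm_constVec, H.left, H.right, H.right_left,
    H.left_right, hye, hyf, smul_eq_mul, map_sub, map_inv₀, map_one, inv_inv, conjRat_C,
    map_zero]
  funext i
  simp only [Pi.add_apply, Pi.sub_apply, Pi.smul_apply, smul_eq_mul]
  field_simp
  ring

/-- For real `r`, the choices `c = i`, `t = r` and `c = -i`, `t = -r` give the coefficients `2ir -
ir²` and `2ir + ir²`. The quadratic terms cancel in the product, leaving `4ir`. -/
lemma HyperbolicPair.generated_siegel_zero {e f : Vec p q} (H : HyperbolicPair e f)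
    {s : RatFunc ℂ} (hs : vInfty s < 1) (hconj : conjRat s = -s) : Generated (siegel f 0 s) := by
  -- The solution of `4ir = s`; it is invariant under `conjRat` because `s` is skew.
  set r : RatFunc ℂ := s * RatFunc.C (-(4 : ℂ)⁻¹ * Complex.I) with hr
  have hrv : vInfty r < 1 := by
    rw [hr, map_mul]; exact mul_lt_one_of_lt_of_le hs (vInfty_C_le _)
  have hrc : conjRat r = r := by
    rw [hr, map_mul, hconj, conjRat_C]; simp [Complex.conj_ofNat]
  have h1 := H.generated_siegel_smul (y := 0) (c := Complex.I) (by simp) (by simp) (by simp) hrv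
  have h2 := H.generated_siegel_smul (y := 0) (c := -Complex.I) (by simp) (by simp) (by simp)
    (t := -r) (by rwa [Valuation.map_neg])
  have h3 := h1.comp h2
  have h4 : 4 * (r * RatFunc.C Complex.I) = s := by
    have e : (4 : RatFunc ℂ) = RatFunc.C 4 := (map_ofNat _ 4).symm
    rw [hr, mul_assoc, ← map_mul, e, mul_left_comm, ← map_mul, mul_assoc, Complex.I_mul_I]
    norm_num
  simp only [constVec_zero, smul_zero, siegel_siegel H.right (map_zero _) (map_zero _), add_zero,
    map_zero] at h3
  convert h3 using 2
  simp only [map_neg, hrc, Complex.conj_I]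
  linear_combination -h4

/-- Removing its components along a hyperbolic pair makes a vector orthogonal to the pair. -/
lemma HyperbolicPair.form_sub {e f : Vec p q} (H : HyperbolicPair e f) (v : Vec p q) :
    form p q e (v - form p q f v • e - form p q e v • f) = 0 ∧
      form p q f (v - form p q f v • e - form p q e v • f) = 0 := by
  simp [H.left, H.right, H.left_right, H.right_left]

/-- Expand `y` in the projections of the basis vectors to the complement of the pair. These are
constant, and their coefficients `y i` vanish at infinity, so each summand comes from
`generated_siegel_smul`. The resulting `c` is not controlled here. -/
lemma HyperbolicPair.exists_generated_siegel {e f : Vec p q} (H : HyperbolicPair e f)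
    {y : Fin p ⊕ Fin q → RatFunc ℂ} (hy : ∀ i, vInfty (y i) < 1)
    (hey : ratForm p q (constVec e) y = 0) (hfy : ratForm p q (constVec f) y = 0) :
    ∃ c, Generated (siegel f y c) := by
  set P : Fin p ⊕ Fin q → Vec p q := fun i => Pi.single i 1 - form p q f (Pi.single i 1) • e -
    form p q e (Pi.single i 1) • f with hP
  have hsum : ∑ i, y i • constVec (P i) = y := by
    have e1 : ∀ u : Vec p q,
        ratForm p q (constVec u) y = ∑ i, y i * RatFunc.C (form p q u (Pi.single i 1)) := by
      intro u
      conv_lhs => rw [pi_eq_sum_univ' y]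
      simp [map_sum, ← constVec_single]
    rw [e1] at hey hfy
    -- The correction terms along `e` and `f` add up to `⟨f, y⟩` and `⟨e, y⟩`, which vanish.
    simp only [hP, constVec_sub, constVec_smul, smul_sub, Finset.sum_sub_distrib, smul_smul,
      ← Finset.sum_smul, hey, hfy, zero_smul, sub_zero, constVec_single]
    exact (pi_eq_sum_univ' y).symm
  have hperp : ∀ s : Finset (Fin p ⊕ Fin q),
      ratForm p q (constVec f) (∑ i ∈ s, y i • constVec (P i)) = 0 := by
    intro s
    rw [map_sum]
    refine Finset.sum_eq_zero fun i _ => ?_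
    simp [hP, (H.form_sub (Pi.single i 1)).2, -map_sub, -constVec_sub]
  have key : ∀ s : Finset (Fin p ⊕ Fin q),
      ∃ c, Generated (siegel f (∑ i ∈ s, y i • constVec (P i)) c) := by
    intro s
    induction s using Finset.induction_on with
    | empty =>
      have e : siegel f 0 0 = fun x => x := by funext x; simp [siegel]
      exact ⟨0, by simpa [e] using generated_id⟩
    | insert i s hi ih =>
      obtain ⟨c, hc⟩ := ih
      -- `-½⟨y, y⟩` is the real solution of `c + conj c + ⟨y, y⟩ = 0`.
      have h1 := H.generated_siegel_smul (y := P i) (c := -(2 : ℂ)⁻¹ * form p q (P i) (P i))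
        (H.form_sub _).1 (H.form_sub _).2
        (by rw [map_mul, form_symm]; simp [Complex.conj_ofNat]; ring) (hy i)
      have h2 := h1.comp hc
      have h3 : ratForm p q (constVec f) (y i • constVec (P i)) = 0 := by
        simpa using hperp {i}
      simp only [siegel_siegel H.right h3 (hperp s)] at h2
      rw [Finset.sum_insert hi]
      exact ⟨_, h2⟩
  simpa only [hsum] using key Finset.univ

lemma HyperbolicPair.generated_siegel {e f : Vec p q} (H : HyperbolicPair e f)
    {y : Fin p ⊕ Fin q → RatFunc ℂ} (hy : ∀ i, vInfty (y i) < 1)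
    (hey : ratForm p q (constVec e) y = 0) (hfy : ratForm p q (constVec f) y = 0)
    {c : RatFunc ℂ} (hc : vInfty c < 1) (hcy : c + conjRat c + ratForm p q y y = 0) :
    Generated (siegel f y c) := by
  obtain ⟨d, hd⟩ := H.exists_generated_siegel hy hey hfy
  have hye : ratForm p q y (constVec e) = 0 := by rw [← conjRat_ratForm, hey, map_zero]
  have hyf : ratForm p q y (constVec f) = 0 := by rw [← conjRat_ratForm, hfy, map_zero]
  -- Both facts are read off from the image of `e`: a generated transformation is normalized at
  -- infinity and preserves `⟨e, e⟩ = 0`.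
  have hd' : vInfty d < 1 ∧ d + conjRat d + ratForm p q y y = 0 := by
    obtain ⟨γ, hγ, hact⟩ := hd
    obtain ⟨hn, hr⟩ := closure_le_rationalLoopGroup hγ
    rw [normalizedAtInfty_iff] at hn
    rw [realityUpq_iff_ratForm] at hr
    have he := (hact (constVec e)).trans (H.siegel_left hey d)
    constructor
    · have := vInfty_ratForm_lt e (hn e)
      simpa [he, hey, H.left, H.left_right] using this
    · have := hr (constVec e) (constVec e)
      simp only [he, map_add, map_smul, map_smulₛₗ, LinearMap.add_apply, LinearMap.smul_apply,
        H.ratForm_left, H.ratForm_right, H.ratForm_right_left, H.ratForm_left_right, hey, hfy,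
        hye, hyf, smul_eq_mul] at this
      linear_combination this
  -- Two admissible coefficients for the same `y` differ by a skew function vanishing at infinity.
  have h0 : Generated (siegel f 0 (c - d)) := by
    refine H.generated_siegel_zero (vInfty.map_sub_lt hc hd'.1) ?_
    rw [map_sub]
    linear_combination hcy - hd'.2
  have h1 := h0.comp hd
  simpa only [siegel_siegel H.right (map_zero _) hfy, zero_add, map_zero, LinearMap.zero_apply,
    sub_zero, sub_add_cancel] using h1

/-! ### Elimination -/

lemma mulVec_inv_eq {γ : RatGL p q} {x y : Fin p ⊕ Fin q → RatFunc ℂ} (h : γ.1 *ᵥ x = y) :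
    (γ⁻¹).1 *ᵥ y = x := by
  rw [← h, mulVec_mulVec, ← Units.val_mul, inv_mul_cancel, Units.val_one, one_mulVec]

/-- The first clause is the elimination step. The other two keep earlier progress: vectors already
fixed stay fixed, and the step can be repeated for the swapped pair without losing its first member.
-/
lemma HyperbolicPair.exists_fix_left {e f : Vec p q} (H : HyperbolicPair e f) {g : RatGL p q}
    (hg : g ∈ rationalLoopGroup p q) :
    ∃ γ ∈ Subgroup.closure (pLoops p q ∪ gLoops p q),
      γ.1 *ᵥ (g.1 *ᵥ constVec e) = constVec e ∧
      (∀ z, ratForm p q (constVec e) z = 0 → ratForm p q (constVec f) z = 0 →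
        ratForm p q (g.1 *ᵥ constVec e) z = 0 → γ.1 *ᵥ z = z) ∧
      (ratForm p q (constVec f) (g.1 *ᵥ constVec e) = 1 → γ.1 *ᵥ constVec f = constVec f) := by
  obtain ⟨hn, hr⟩ := hg
  rw [normalizedAtInfty_iff] at hn
  rw [realityUpq_iff_ratForm] at hr
  set x := g.1 *ᵥ constVec e with hx
  have hxx : ratForm p q x x = 0 := by rw [hx, hr, H.ratForm_left]
  have hxe := hn e
  rw [← hx] at hxe
  set a := ratForm p q (constVec f) x with ha
  set b := ratForm p q (constVec e) x with hb
  have ha1 : vInfty (a - 1) < 1 := by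
    simpa [H.right_left] using vInfty_ratForm_lt f hxe
  have hb1 : vInfty b < 1 := by
    simpa [H.left] using vInfty_ratForm_lt e hxe
  have hva := vInfty_eq_one ha1
  have ha0 : a ≠ 0 := by intro h; simp [h] at hva
  have ha0' : conjRat a ≠ 0 := (map_ne_zero _).2 ha0
  -- Chosen so that `x = a (e + y + a⁻¹ b f)` with `y` orthogonal to the pair: the image of `e`
  -- under a torus element followed by a Siegel transformation.
  set y := a⁻¹ • (x - a • constVec e - b • constVec f) with hy
  have hey : ratForm p q (constVec e) y = 0 := by
    simp [hy, H.left, H.left_right, ← hb]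
  have hfy : ratForm p q (constVec f) y = 0 := by
    simp [hy, H.right, H.right_left, ← ha]
  have hyv : ∀ i, vInfty (y i) < 1 := by
    intro i
    have e1 : y i = a⁻¹ * ((x - constVec e) i - (a - 1) * constVec e i - b * constVec f i) := by
      simp only [hy, Pi.sub_apply, Pi.smul_apply, smul_eq_mul]; ring
    rw [e1, map_mul, map_inv₀, hva, inv_one, one_mul]
    refine vInfty.map_sub_lt (vInfty.map_sub_lt (hxe i) ?_) ?_
    · rw [map_mul]; exact mul_lt_one_of_lt_of_le ha1 (vInfty_C_le _)
    · rw [map_mul]; exact mul_lt_one_of_lt_of_le hb1 (vInfty_C_le _)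
  have hcv : vInfty (a⁻¹ * b) < 1 := by rw [map_mul, map_inv₀, hva]; simpa using hb1
  have hxe' : ratForm p q x (constVec e) = conjRat b := by rw [hb, conjRat_ratForm]
  have hxf' : ratForm p q x (constVec f) = conjRat a := by rw [ha, conjRat_ratForm]
  -- This is `⟨x, x⟩ = 0` divided by `a * conj a`.
  have hcy : a⁻¹ * b + conjRat (a⁻¹ * b) + ratForm p q y y = 0 := by
    simp only [hy, map_sub, map_smul, map_smulₛₗ, LinearMap.sub_apply, LinearMap.smul_apply,
      H.ratForm_left, H.ratForm_right, H.ratForm_right_left, H.ratForm_left_right, hxx, hxe', hxf',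
      ← ha, ← hb, smul_eq_mul, map_mul, map_inv₀]
    field_simp
    ring
  obtain ⟨γ, hγ, hact⟩ := (H.generated_siegel hyv hey hfy hcv hcy).comp (H.generated_torus ha1)
  beta_reduce at hact
  refine ⟨γ⁻¹, inv_mem hγ, mulVec_inv_eq ?_, fun z hez hfz hxz => mulVec_inv_eq ?_,
    fun h => mulVec_inv_eq ?_⟩
  · have e1 : torus e f a (constVec e) = a • constVec e := by
      simp [torus_apply, H.left, H.right_left, sub_smul]
    have e2 : siegel f y (a⁻¹ * b) (a • constVec e) = a • siegel f y (a⁻¹ * b) (constVec e) := by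
      simp only [siegel, map_smul, smul_add, smul_sub, smul_assoc]
    rw [hact, e1, e2, H.siegel_left hey, hy]
    simp only [smul_add, smul_smul, mul_inv_cancel₀ ha0, mul_inv_cancel_left₀ ha0, one_smul]
    abel
  · have e1 : torus e f a z = z := by simp [torus_apply, hez, hfz]
    have e2 : ratForm p q y z = 0 := by
      simp [hy, hez, hfz, hxz]
    rw [hact, e1]
    simp [siegel, hfz, e2]
  · have hyf : ratForm p q y (constVec f) = 0 := by rw [← conjRat_ratForm, hfy, map_zero]
    rw [hact, h, torus_one]
    simp [siegel, H.right, hyf]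

lemma HyperbolicPair.exists_fix {e f : Vec p q} (H : HyperbolicPair e f) {g : RatGL p q}
    (hg : g ∈ rationalLoopGroup p q) :
    ∃ γ ∈ Subgroup.closure (pLoops p q ∪ gLoops p q),
      (γ * g).1 *ᵥ constVec e = constVec e ∧ (γ * g).1 *ᵥ constVec f = constVec f ∧
      ∀ z, ratForm p q (constVec e) z = 0 → ratForm p q (constVec f) z = 0 →
        g.1 *ᵥ z = z → (γ * g).1 *ᵥ z = z := by
  have hmul : ∀ (γ δ : RatGL p q) x, (γ * δ).1 *ᵥ x = γ.1 *ᵥ (δ.1 *ᵥ x) := fun γ δ x => by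
    rw [Units.val_mul, mulVec_mulVec]
  have hr : ∀ δ ∈ rationalLoopGroup p q, ∀ x y,
      ratForm p q (δ.1 *ᵥ x) (δ.1 *ᵥ y) = ratForm p q x y :=
    fun δ hδ => (realityUpq_iff_ratForm δ).1 hδ.2
  obtain ⟨γ, hγ, h1, h2, -⟩ := H.exists_fix_left hg
  have hγg : γ * g ∈ rationalLoopGroup p q := mul_mem (closure_le_rationalLoopGroup hγ) hg
  obtain ⟨δ, hδ, h3, h4, h5⟩ := H.symm.exists_fix_left hγg
  rw [← hmul] at h1
  refine ⟨δ * γ, mul_mem hδ hγ, ?_, ?_, fun z hez hfz hz => ?_⟩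
  · rw [mul_assoc, hmul, h1]
    apply h5
    -- As `γ * g` is an isometry fixing `e`, the image of `f` still pairs to 1 with `e`, so the
    -- second pass leaves `e` fixed.
    have := hr _ hγg (constVec e) (constVec f)
    rwa [h1, H.ratForm_left_right] at this
  · rw [mul_assoc, hmul, h3]
  · have h6 : (γ * g).1 *ᵥ z = z := by
      rw [hmul, hz]
      refine h2 z hez hfz ?_
      -- Since `g` fixes `z`, `⟨g e, z⟩ = ⟨g e, g z⟩ = ⟨e, z⟩ = 0`.
      have := hr g hg (constVec e) z
      rwa [hz, hez] at this
    rw [mul_assoc, hmul, h6]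
    refine h4 z hfz hez ?_
    have := hr _ hγg (constVec f) z
    rwa [h6, hfz] at this

lemma form_single (i j : Fin p ⊕ Fin q) :
    form p q (Pi.single i 1) (Pi.single j 1) =
      if i = j then Sum.elim (fun _ => -1) (fun _ => 1) i else 0 := by
  have h := ratForm_constVec (p := p) (q := q) (Pi.single i 1) (Pi.single j 1)
  rw [constVec_single, constVec_single, ratForm_single] at h
  apply RatFunc.C_injective
  rw [← h]
  rcases i with i | i <;> rcases j with j | j <;>
    simp [Pi.single_apply, apply_ite RatFunc.C]

lemma exists_fix_single {g : RatGL p q} (hg : g ∈ rationalLoopGroup p q) (i : Fin p) (j : Fin q) :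
    ∃ γ ∈ Subgroup.closure (pLoops p q ∪ gLoops p q), ∀ k,
      k = Sum.inl i ∨ k = Sum.inr j ∨ g.1 *ᵥ Pi.single k 1 = Pi.single k 1 →
        (γ * g).1 *ᵥ Pi.single k 1 = Pi.single k 1 := by
  set u : Vec p q := Pi.single (Sum.inl i) 1 with hu
  set w : Vec p q := Pi.single (Sum.inr j) 1 with hw
  have huu : form p q u u = -1 := by simp [hu, form_single]
  have huw : form p q u w = 0 := by simp [hu, hw, form_single]
  have hwu : form p q w u = 0 := by simp [hu, hw, form_single]
  have hww : form p q w w = 1 := by simp [hw, form_single]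
  -- A negative and a positive basis vector span a hyperbolic plane, so fixing this pair amounts to
  -- fixing `u` and `w`.
  have H : HyperbolicPair (u + w) ((2 : ℂ)⁻¹ • (w - u)) := by
    constructor
    · simp [huu, huw, hwu, hww]
    · simp [huu, huw, hwu, hww]
    · simp [huu, huw, hwu, hww, Complex.conj_ofNat]; norm_num
  obtain ⟨γ, hγ, he, hf, hz⟩ := H.exists_fix hg
  have eu : constVec u = RatFunc.C (2 : ℂ)⁻¹ • constVec (u + w) -
      constVec ((2 : ℂ)⁻¹ • (w - u)) := by
    rw [← constVec_smul, ← constVec_sub]; congr 1; module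
  have ew : constVec w = RatFunc.C (2 : ℂ)⁻¹ • constVec (u + w) +
      constVec ((2 : ℂ)⁻¹ • (w - u)) := by
    rw [← constVec_smul, ← constVec_add]; congr 1; module
  have fu : (γ * g).1 *ᵥ Pi.single (Sum.inl i) 1 = Pi.single (Sum.inl i) 1 := by
    rw [← constVec_single, ← hu, eu, mulVec_sub, mulVec_smul, he, hf]
  have fw : (γ * g).1 *ᵥ Pi.single (Sum.inr j) 1 = Pi.single (Sum.inr j) 1 := by
    rw [← constVec_single, ← hw, ew, mulVec_add, mulVec_smul, he, hf]
  refine ⟨γ, hγ, fun k hk => ?_⟩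
  by_cases hki : k = Sum.inl i
  · rw [hki, fu]
  by_cases hkj : k = Sum.inr j
  · rw [hkj, fw]
  have h1 : form p q u (Pi.single k 1) = 0 := by rw [hu, form_single, if_neg (Ne.symm hki)]
  have h2 : form p q w (Pi.single k 1) = 0 := by rw [hw, form_single, if_neg (Ne.symm hkj)]
  refine hz _ ?_ ?_ (by tauto)
  · rw [← constVec_single, ratForm_constVec]
    simp [h1, h2]
  · rw [← constVec_single, ratForm_constVec]
    simp [h1, h2]

/-- Each coordinate is paired with a base coordinate `i₀` or `j₀` of opposite sign. The base vectors
may be moved again by later steps, so they are exempt from the hypothesis and fixed together once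
`s` is empty. -/
lemma mem_closure_of_fix (i₀ : Fin p) (j₀ : Fin q) (s : Finset (Fin p ⊕ Fin q)) :
    ∀ g ∈ rationalLoopGroup p q,
      (∀ k ∉ s, k ≠ Sum.inl i₀ → k ≠ Sum.inr j₀ → g.1 *ᵥ Pi.single k 1 = Pi.single k 1) →
      g ∈ Subgroup.closure (pLoops p q ∪ gLoops p q) := by
  have descend : ∀ (g γ : RatGL p q), γ ∈ Subgroup.closure (pLoops p q ∪ gLoops p q) →
      γ * g ∈ Subgroup.closure (pLoops p q ∪ gLoops p q) →
      g ∈ Subgroup.closure (pLoops p q ∪ gLoops p q) :=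
    fun g γ hγ h => (Subgroup.mul_mem_cancel_left _ hγ).1 h
  induction s using Finset.induction_on with
  | empty =>
    intro g hg h
    obtain ⟨γ, hγ, hfix⟩ := exists_fix_single hg i₀ j₀
    refine descend g γ hγ ?_
    have e : γ * g = 1 := by
      refine Units.ext (Matrix.ext_of_mulVec_single fun k => ?_)
      rw [hfix k, Units.val_one, one_mulVec]
      have := h k (Finset.notMem_empty k)
      tauto
    rw [e]
    exact one_mem _
  | insert k s hk ih =>
    intro g hg h
    obtain ⟨i, j, hkij, hi, hj⟩ : ∃ (i : Fin p) (j : Fin q), (k = Sum.inl i ∨ k = Sum.inr j) ∧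
        (k = Sum.inl i ∨ i = i₀) ∧ (k = Sum.inr j ∨ j = j₀) := by
      rcases k with i | j
      · exact ⟨i, j₀, by simp⟩
      · exact ⟨i₀, j, by simp⟩
    obtain ⟨γ, hγ, hfix⟩ := exists_fix_single hg i j
    refine descend g γ hγ (ih _ (mul_mem (closure_le_rationalLoopGroup hγ) hg) ?_)
    intro l hl hl1 hl2
    apply hfix
    by_cases hlk : l = k
    · rw [hlk]; tauto
    · exact Or.inr (Or.inr (h l (by simp [hlk, hl]) hl1 hl2))

end LoopUpq

end

theorem mainTheorem1 (p q : ℕ) (hp : 0 < p) (hpq : p ≤ q) :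
    Subgroup.closure (LoopUpq.pLoops p q ∪ LoopUpq.gLoops p q) =
      LoopUpq.rationalLoopGroup p q := by
  refine le_antisymm LoopUpq.closure_le_rationalLoopGroup fun g hg => ?_
  -- With all coordinates in `s`, nothing needs to be fixed at the start; `0 < p ≤ q` supplies base
  -- coordinates of both signs.
  exact LoopUpq.mem_closure_of_fix ⟨0, hp⟩ ⟨0, hp.trans_le hpq⟩ Finset.univ g hg (by simp)
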